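/- Let $\mathcal X$ be a reflexive real Banach space with topological dual $\mathcal X^*$. For $g:\mathcal X\to\,]-\infty,+\infty]$ write $\operatorname{dom} g=\{x: g(x)<+\infty\}$, and let $\Gamma_0(\mathcal X)$ be the set of lower semicontinuous convex $g:\mathcal X\to\,]-\infty,+\infty]$ with $\operatorname{dom} g\neq\varnothing$. If $g$ is Gâteaux differentiable on $\operatorname{int}\operatorname{dom} g$, its Bregman distance is $D^g(x,y)=g(x)-g(y)-\langle x-y,\nabla g(y)\rangle$ if $y\in\operatorname{int}\operatorname{dom} g$ and $D^g(x,y)=+\infty$ otherwise; for $C\subset\mathcal X$ put $D^g_C(y)=\inf_{x\in C}D^g(x,y)$. Let $f\in\Gamma_0(\mathcal X)$ be Gâteaux differentiable on $\operatorname{int}\operatorname{dom} f\ne\varnothing$. Let $f$ be a Legendre function: the subdifferential $\partial f$ is locally bounded and single-valued on its domain, the subdifferential $\partial f^*$ of the conjugate $f^*$ is locally bounded on its domain, and $f$ is strictly convex on every convex subset of $\operatorname{dom}\partial f$. Put $\hat f=f$ on $\operatorname{int}\operatorname{dom} f$ and $\hat f=+\infty$ elsewhere. Let $\mathcal F(f)$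 be the set of $g\in\Gamma_0(\mathcal X)$ such that $\operatorname{dom} g=\operatorname{int}\operatorname{dom} f$ and $g$ is Gâteaux differentiable on $\operatorname{dom} g$, and write $g_2\preccurlyeq g_1$ if $D^{g_2}(x,y)\le D^{g_1}(x,y)$ for all $x\in\operatorname{dom} f$ and $y\in\operatorname{int}\operatorname{dom} f$. Let $\alpha,\beta\in\,]0,+\infty[$, let $(f_n)_{n\in\mathbb N}$ be a sequence in $\mathcal F(f)$ such that $\alpha f\preccurlyeq f_n\preccurlyeq\beta\hat f$ for every $n\in\mathbb N$, let $(x_n)_{n\in\mathbb N}$ be a sequence in $\operatorname{int}\operatorname{dom} f$, and let $C\subset\mathcal X$ be closed and convex with $C\cap\operatorname{int}\operatorname{dom} f\neq\varnothing$. Suppose that: 1. $(x_n)$ is stationarily quasi-Bregman monotone with respect to $C$ relative to $(f_n)$: there are summable sequences $(\varepsilon_n)$ and $(\eta_n)$ in $[0,+\infty[$ such that $D^{f_{n+1}}(x,x_{n+1})\le(1+\eta_n)D^{f_n}(x,x_n)+\varepsilon_n$ for all $x\in C\cap\operatorname{dom} f$ and all $n\in\mathbb N$; 2. for all bounded sequences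 $(u_n)$ and $(v_n)$ in $\operatorname{int}\operatorname{dom} f$, $D^f(u_n,v_n)\to0$ implies $u_n-v_n\to0$; 3. for every $x\in\operatorname{int}\operatorname{dom} f$, $D^f(x,\cdot)$ is coercive, i.e. $D^f(x,y)\to+\infty$ as $\|y\|\to+\infty$. Then $(x_n)$ converges strongly to a point of $C\cap\overline{\operatorname{dom} f}$ if and only if $\varliminf_{n\to\infty} D^f_C(x_n)=0$. -/

import Mathlib

open Filter Topology

noncomputable section

namespace QuasiBregman

variable {E : Type*} [NormedAddCommGroup E] [NormedSpace ℝ E]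

/-- A real normed space is reflexive if the canonical embedding into its bidual is onto. -/
def IsReflexive (E : Type*) [NormedAddCommGroup E] [NormedSpace ℝ E] : Prop :=
  Function.Surjective (NormedSpace.inclusionInDoubleDual ℝ E)

/-- The domain `{x | f x < +∞}` of an extended-real-valued function. -/
def dom (f : E → EReal) : Set E := {x | f x < ⊤}

/-- The proper lower semicontinuous convex functions with values in `]-∞, +∞]`.
As `-∞` is not a value, convexity of `f` means that `dom f` is convex and that the real-valued
restriction of `f` to `dom f` is convex. -/
structure IsGamma0 (f : E → EReal) : Prop where
  ne_bot : ∀ x, f x ≠ ⊥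
  nonempty_dom : (dom f).Nonempty
  convexOn : ConvexOn ℝ (dom f) (fun x => (f x).toReal)
  lowerSemicontinuous : LowerSemicontinuous f

/-- The continuous linear functional `u` is the Gâteaux derivative of `f` at `x`.
(Used at points `x` in the interior of `dom f`, where `f` is real-valued near `x`.) -/
def HasGateauxDerivAt (f : E → EReal) (u : StrongDual ℝ E) (x : E) : Prop :=
  ∀ v : E, HasLineDerivAt ℝ (fun z => (f z).toReal) (u v) x v

/-- `f` is Gâteaux differentiable on the interior of its domain. -/
def IsGateauxDiff (f : E → EReal) : Prop :=
  ∀ x ∈ interior (dom f), ∃ u : StrongDual ℝ E, HasGateauxDerivAt f u x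

open Classical in
/-- The Gâteaux gradient of `f` at `x` (with value `0` where it does not exist). -/
def grad (f : E → EReal) (x : E) : StrongDual ℝ E :=
  if h : ∃ u : StrongDual ℝ E, HasGateauxDerivAt f u x then h.choose else 0

open Classical in
/-- The Bregman distance `D^f`. -/
def bregmanDist (f : E → EReal) (x y : E) : EReal :=
  if y ∈ interior (dom f) then f x - f y - ((grad f y (x - y) : ℝ) : EReal) else ⊤

/-- The `D^f`-distance to `C`, that is `y ↦ inf D^f(C, y)`. -/
def bregmanDistSet (f : E → EReal) (C : Set E) (y : E) : EReal :=
  ⨅ x ∈ C, bregmanDist f x y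

/-- The Moreau subdifferential of `f`. -/
def subdiff (f : E → EReal) (x : E) : Set (StrongDual ℝ E) :=
  {u | ∀ y : E, ((u (y - x) : ℝ) : EReal) + f x ≤ f y}

/-- The Fenchel conjugate of `f`. -/
def conj (f : E → EReal) (u : StrongDual ℝ E) : EReal :=
  ⨆ x : E, ((u x : ℝ) : EReal) - f x

/-- The domain of the subdifferential of `f`. -/
def domSubdiff (f : E → EReal) : Set E := {x | (subdiff f x).Nonempty}

/-- The subdifferential of `f` is locally bounded on its domain: each point of the domain has a
neighbourhood whose image is bounded. -/
def SubdiffLocallyBounded (f : E → EReal) : Prop :=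
  ∀ x ∈ domSubdiff f, ∃ U ∈ 𝓝 x, Bornology.IsBounded (⋃ z ∈ U, subdiff f z)

/-- `f` is essentially smooth: its subdifferential is locally bounded and single-valued on its
domain. -/
def IsEssentiallySmooth (f : E → EReal) : Prop :=
  SubdiffLocallyBounded f ∧ ∀ x, (subdiff f x).Subsingleton

/-- `f` is essentially strictly convex: the subdifferential of its conjugate is locally bounded on
its domain, and `f` is strictly convex on every convex subset of the domain of its subdifferential
(`f` is real-valued there when it is proper). The subdifferential of the conjugate is a subset of
the bidual of `E`, which is isometric to `E` when `E` is reflexive. -/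
def IsEssentiallyStrictlyConvex (f : E → EReal) : Prop :=
  SubdiffLocallyBounded (conj f) ∧
    ∀ S : Set E, S ⊆ domSubdiff f → Convex ℝ S → StrictConvexOn ℝ S (fun x => (f x).toReal)

/-- Legendre functions. -/
def IsLegendre (f : E → EReal) : Prop :=
  IsEssentiallySmooth f ∧ IsEssentiallyStrictlyConvex f

/-- The function that equals `f` on the interior of `dom f` and `+∞` elsewhere. -/
def hat (f : E → EReal) (x : E) : EReal :=
  open Classical in if x ∈ interior (dom f) then f x else ⊤

/-- The multiple `α f` of an extended-real-valued function. -/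
def scale (α : ℝ) (f : E → EReal) (x : E) : EReal := (α : EReal) * f x

/-- The class `ℱ(f)`: members of `Γ₀` that are Gâteaux differentiable on their domain, which is
the interior of `dom f` (hence open). -/
def classF (f : E → EReal) : Set (E → EReal) :=
  {g | IsGamma0 g ∧ dom g = interior (dom f) ∧ IsGateauxDiff g}

/-- The relation `g₂ ≼ g₁` relative to `f`: domination of the Bregman distances. -/
def bregmanLE (f g₂ g₁ : E → EReal) : Prop :=
  ∀ x ∈ dom f, ∀ y ∈ interior (dom f), bregmanDist g₂ x y ≤ bregmanDist g₁ x y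

/-- The class `𝒫_α(f)` of the members `g` of `ℱ(f)` with `α f ≼ g`. -/
def classP (α : ℝ) (f : E → EReal) : Set (E → EReal) :=
  {g | g ∈ classF f ∧ bregmanLE f (scale α f) g}

/-- Summable sequences of nonnegative reals. -/
def IsSummableNonneg (η : ℕ → ℝ) : Prop := (∀ n, 0 ≤ η n) ∧ Summable η

/-- `x` is stationarily quasi-Bregman monotone with respect to `C` relative to `fs`. -/
def IsStationarilyQuasiBregmanMonotone (f : E → EReal) (fs : ℕ → E → EReal) (C : Set E)
    (x : ℕ → E) : Prop :=
  ∃ ε : ℕ → ℝ, IsSummableNonneg ε ∧ ∃ η : ℕ → ℝ, IsSummableNonneg η ∧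
    ∀ z ∈ C ∩ dom f, ∀ n : ℕ,
      bregmanDist (fs (n + 1)) z (x (n + 1)) ≤
        ((1 + η n : ℝ) : EReal) * bregmanDist (fs n) z (x n) + ((ε n : ℝ) : EReal)

/-- For all bounded sequences `u`, `v` in the interior of `dom f`, `D^f(u n, v n) → 0` implies
`u n - v n → 0`. -/
def BregmanConsistent (f : E → EReal) : Prop :=
  ∀ u v : ℕ → E, (∀ n, u n ∈ interior (dom f)) → (∀ n, v n ∈ interior (dom f)) →
    Bornology.IsBounded (Set.range u) → Bornology.IsBounded (Set.range v) →
    Tendsto (fun n => bregmanDist f (u n) (v n)) atTop (𝓝 0) →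
    Tendsto (fun n => u n - v n) atTop (𝓝 0)

/-- `φ` is coercive: `φ z → +∞` as `‖z‖ → +∞`. -/
def IsCoercive (φ : E → EReal) : Prop := Tendsto φ (Bornology.cobounded E) (𝓝 ⊤)

end QuasiBregman

end

open Filter Topology

namespace QuasiBregman

section Bregman

set_option linter.unusedSectionVars false

variable {X : Type*} [NormedAddCommGroup X] [NormedSpace ℝ X] {f g : X → EReal} {x y z : X}

/-! Chaining the monotonicity recursion and sandwiching it between the two Bregman comparisons
gives, for p in C ∩ int dom f and m ≥ n, a bound on D^f(p, x_m) by a constant times β D^f(p, x_n)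
plus a tail of ε (`le_exp_mul_of_le_mul_add`): once close to p, the sequence stays close. If the
liminf is 0, such a p exists for some late n, and consistency turns Bregman closeness into norm
closeness (`BregmanConsistent.exists_delta`). Hence (x_n) is Cauchy and its limit is approached by
points of C. Conversely, D^f(z, x_n) is bounded for an interior z in C, which bounds the gradients
at x_n (`exists_norm_grad_le`). Lower semicontinuity then forces D^f(xbar, x_n) → 0, even for xbar
on the boundary of dom f (`tendsto_bregmanDist_of_norm_grad_le`). -/

theorem coe_toReal_of_mem_dom (hb : ∀ x, f x ≠ ⊥) (hx : x ∈ dom f) :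
    ((f x).toReal : EReal) = f x :=
  EReal.coe_toReal (ne_of_lt hx) (hb x)

/-! ### Gradients and the real-valued Bregman distance -/

theorem HasGateauxDerivAt.grad_eq {u : StrongDual ℝ X} (h : HasGateauxDerivAt f u x) :
    grad f x = u := by
  have hex : ∃ u : StrongDual ℝ X, HasGateauxDerivAt f u x := ⟨u, h⟩
  rw [grad, dif_pos hex]
  ext v
  exact (hex.choose_spec v).unique (h v)

theorem IsGateauxDiff.hasGateauxDerivAt_grad (hfd : IsGateauxDiff f)
    (hx : x ∈ interior (dom f)) : HasGateauxDerivAt f (grad f x) x := by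
  obtain ⟨u, hu⟩ := hfd x hx
  rwa [hu.grad_eq]

/-- The Bregman distance as a real number, meaningful for `x ∈ dom f` and `y ∈ int dom f`. -/
noncomputable def realBregmanDist (f : X → EReal) (x y : X) : ℝ :=
  (f x).toReal - (f y).toReal - grad f y (x - y)

theorem bregmanDist_eq_coe (hb : ∀ x, f x ≠ ⊥) (hx : x ∈ dom f) (hy : y ∈ interior (dom f)) :
    bregmanDist f x y = (realBregmanDist f x y : EReal) := by
  rw [bregmanDist, if_pos hy, realBregmanDist, EReal.coe_sub, EReal.coe_sub,
    coe_toReal_of_mem_dom hb hx, coe_toReal_of_mem_dom hb (interior_subset hy)]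

theorem bregmanDist_eq_top (hb : ∀ x, f x ≠ ⊥) (hx : x ∉ dom f) (hy : y ∈ interior (dom f)) :
    bregmanDist f x y = ⊤ := by
  have hx' : f x = ⊤ := not_lt_top_iff.mp hx
  rw [bregmanDist, if_pos hy, hx', ← coe_toReal_of_mem_dom hb (interior_subset hy),
    EReal.top_sub_coe, EReal.top_sub_coe]

/-- The gradient inequality for convex functions. -/
theorem realBregmanDist_nonneg (hf : IsGamma0 f) (hfd : IsGateauxDiff f) (hx : x ∈ dom f)
    (hy : y ∈ interior (dom f)) : 0 ≤ realBregmanDist f x y := by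
  have hd := hfd.hasGateauxDerivAt_grad hy (x - y)
  have hc := hf.convexOn.comp_affineMap (AffineMap.lineMap y x : ℝ →ᵃ[ℝ] X)
  have hder : HasDerivAt ((fun z => (f z).toReal) ∘ (AffineMap.lineMap y x : ℝ →ᵃ[ℝ] X))
      (grad f y (x - y)) 0 := by
    refine HasDerivAt.congr_of_eventuallyEq (f := fun t : ℝ => (f (y + t • (x - y))).toReal) hd ?_
    filter_upwards with t
    simp [AffineMap.lineMap_apply, add_comm]
  have h := hc.le_slope_of_hasDerivAt (x := 0) (y := 1)
    (by simpa using interior_subset hy) (by simpa using hx) one_pos hder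
  simp [slope_def_field] at h
  rw [realBregmanDist, map_sub]
  linarith

theorem bregmanDist_nonneg (hf : IsGamma0 f) (hfd : IsGateauxDiff f)
    (hy : y ∈ interior (dom f)) : 0 ≤ bregmanDist f x y := by
  by_cases hx : x ∈ dom f
  · rw [bregmanDist_eq_coe hf.ne_bot hx hy]
    exact_mod_cast realBregmanDist_nonneg hf hfd hx hy
  · rw [bregmanDist_eq_top hf.ne_bot hx hy]
    exact le_top

theorem realBregmanDist_self : realBregmanDist f y y = 0 := by
  simp [realBregmanDist]

/-- The Bregman distance is convex in its first argument. -/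
theorem realBregmanDist_convex (hf : IsGamma0 f) (hx : x ∈ dom f) (hz : z ∈ dom f)
    {a b : ℝ} (ha : 0 ≤ a) (hb : 0 ≤ b) (hab : a + b = 1) :
    realBregmanDist f (a • x + b • z) y ≤
      a * realBregmanDist f x y + b * realBregmanDist f z y := by
  have h := hf.convexOn.2 hx hz ha hb hab
  simp only [smul_eq_mul] at h
  have hlin : a • x + b • z - y = a • (x - y) + b • (z - y) := by
    have : y = (a + b) • y := by rw [hab, one_smul]
    nth_rewrite 1 [this]
    module
  simp only [realBregmanDist, hlin, map_add, map_smul, smul_eq_mul]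
  have hF : (f y).toReal = a * (f y).toReal + b * (f y).toReal := by rw [← add_mul, hab, one_mul]
  linarith

/-! ### Scaling, restriction to the interior, and comparison of distances -/

theorem dom_scale {α : ℝ} (hα : 0 < α) : dom (scale α f) = dom f := by
  ext z
  change (α : EReal) * f z < ⊤ ↔ f z < ⊤
  rw [lt_top_iff_ne_top, lt_top_iff_ne_top]
  refine not_congr ⟨fun h => ?_, fun h => by rw [h, EReal.coe_mul_top_of_pos hα]⟩
  induction hz : f z with
  | bot => rw [hz, EReal.coe_mul_bot_of_pos hα] at h; simp at h
  | coe a => exact absurd (by rwa [hz, ← EReal.coe_mul] at h) (EReal.coe_ne_top _)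
  | top => rfl

theorem bregmanDist_scale {α : ℝ} (hα : 0 < α) (hb : ∀ x, f x ≠ ⊥) (hfd : IsGateauxDiff f)
    (hx : x ∈ dom f) (hy : y ∈ interior (dom f)) :
    bregmanDist (scale α f) x y = ((α * realBregmanDist f x y : ℝ) : EReal) := by
  have hsb : ∀ z ∈ dom f, scale α f z = ((α * (f z).toReal : ℝ) : EReal) := fun z hz => by
    rw [scale, EReal.coe_mul, coe_toReal_of_mem_dom hb hz]
  have hgrad : grad (scale α f) y = α • grad f y := by
    apply HasGateauxDerivAt.grad_eq
    intro v
    have hd : HasDerivAt _ _ _ := HasDerivAt.const_mul α (hfd.hasGateauxDerivAt_grad hy v)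
    refine HasDerivAt.congr_of_eventuallyEq hd ?_
    filter_upwards with t
    simp [scale, EReal.toReal_mul]
  rw [bregmanDist, dom_scale hα, if_pos hy, hsb x hx, hsb y (interior_subset hy), hgrad,
    ← EReal.coe_sub, ← EReal.coe_sub, EReal.coe_eq_coe_iff, realBregmanDist]
  simp only [smul_apply, smul_eq_mul]
  ring

theorem hat_apply (hx : x ∈ interior (dom f)) : hat f x = f x := if_pos hx

theorem hat_apply_of_notMem (hx : x ∉ interior (dom f)) : hat f x = ⊤ := if_neg hx

theorem dom_hat : dom (hat f) = interior (dom f) := by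
  ext z
  change hat f z < ⊤ ↔ _
  by_cases hz : z ∈ interior (dom f)
  · rw [hat_apply hz]
    exact iff_of_true (show z ∈ dom f from interior_subset hz) hz
  · rw [hat_apply_of_notMem hz]
    exact iff_of_false (lt_irrefl _) hz

theorem hat_ne_bot (hb : ∀ x, f x ≠ ⊥) (x : X) : hat f x ≠ ⊥ := by
  by_cases hx : x ∈ interior (dom f)
  · rw [hat_apply hx]; exact hb x
  · rw [hat_apply_of_notMem hx]; exact top_ne_bot

/-- For small t the point x + t • v stays in the open interior, where the two functions agree. -/
theorem HasGateauxDerivAt.hat {u : StrongDual ℝ X} (hx : x ∈ interior (dom f))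
    (h : HasGateauxDerivAt f u x) : HasGateauxDerivAt (hat f) u x := by
  intro v
  refine HasDerivAt.congr_of_eventuallyEq (h v) ?_
  have hcont : ContinuousAt (fun t : ℝ => x + t • v) 0 := by fun_prop
  filter_upwards [hcont (isOpen_interior.mem_nhds (by simpa using hx))] with t ht
  rw [hat_apply ht]

theorem IsGateauxDiff.hat (hfd : IsGateauxDiff f) : IsGateauxDiff (hat f) := by
  intro z hz
  rw [dom_hat, interior_interior] at hz
  exact ⟨_, (hfd.hasGateauxDerivAt_grad hz).hat hz⟩

theorem realBregmanDist_hat (hfd : IsGateauxDiff f)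
    (hx : x ∈ interior (dom f)) (hy : y ∈ interior (dom f)) :
    realBregmanDist (hat f) x y = realBregmanDist f x y := by
  rw [realBregmanDist, ((hfd.hasGateauxDerivAt_grad hy).hat hy).grad_eq, hat_apply hx,
    hat_apply hy, realBregmanDist]

theorem bregmanDist_le_mul_of_bregmanLE_hat {β : ℝ} (hβ : 0 < β) (hb : ∀ x, f x ≠ ⊥)
    (hfd : IsGateauxDiff f) (h : bregmanLE f g (scale β (hat f)))
    (hx : x ∈ interior (dom f)) (hy : y ∈ interior (dom f)) :
    bregmanDist g x y ≤ ((β * realBregmanDist f x y : ℝ) : EReal) := by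
  have hd : interior (dom (hat f)) = interior (dom f) := by
    rw [dom_hat, interior_interior]
  have h' := h x (interior_subset hx) y hy
  rwa [bregmanDist_scale hβ (hat_ne_bot hb) hfd.hat (by rwa [dom_hat])
    (by rwa [hd]),
    realBregmanDist_hat hfd hx hy] at h'

theorem mul_realBregmanDist_le_of_bregmanLE {α c : ℝ} (hα : 0 < α) (hb : ∀ x, f x ≠ ⊥)
    (hfd : IsGateauxDiff f) (h : bregmanLE f (scale α f) g)
    (hx : x ∈ dom f) (hy : y ∈ interior (dom f)) (hc : bregmanDist g x y ≤ (c : EReal)) :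
    α * realBregmanDist f x y ≤ c := by
  have h' := (h x hx y hy).trans hc
  rw [bregmanDist_scale hα hb hfd hx hy] at h'
  exact_mod_cast h'

/-! ### Quasi-monotone recursions -/

/-- A discrete Gronwall bound. The whole sum of η makes the factor independent of n, while ε enters
only through its tail, which vanishes as n grows. -/
theorem le_exp_mul_of_le_mul_add {a : ℕ → EReal} {ε η : ℕ → ℝ} (hε : IsSummableNonneg ε)
    (hη : IsSummableNonneg η)
    (ha : ∀ n, a (n + 1) ≤ ((1 + η n : ℝ) : EReal) * a n + ((ε n : ℝ) : EReal))
    {n : ℕ} {c : ℝ} (hc : 0 ≤ c) (hn : a n ≤ (c : EReal)) {m : ℕ} (hm : n ≤ m) :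
    a m ≤ ((Real.exp (∑' k, η k) * (c + ∑' k, ε (k + n)) : ℝ) : EReal) := by
  have key : ∀ j, a (n + j) ≤ ((Real.exp (∑ k ∈ Finset.range j, η (k + n)) *
      (c + ∑ k ∈ Finset.range j, ε (k + n)) : ℝ) : EReal) := by
    intro j
    induction j with
    | zero => simpa using hn
    | succ j ih =>
      have hpos : (0 : EReal) ≤ ((1 + η (n + j) : ℝ) : EReal) := by
        exact_mod_cast add_nonneg zero_le_one (hη.1 _)
      refine (ha (n + j)).trans ((add_le_add_left (mul_le_mul_of_nonneg_left ih hpos) _).trans ?_)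
      rw [← EReal.coe_mul, ← EReal.coe_add, EReal.coe_le_coe_iff, Finset.sum_range_succ,
        Finset.sum_range_succ, Real.exp_add, add_comm j n]
      set A := ∑ k ∈ Finset.range j, η (k + n)
      set B := ∑ k ∈ Finset.range j, ε (k + n)
      have hA : 0 ≤ A := Finset.sum_nonneg fun k _ => hη.1 _
      have hB : 0 ≤ B := Finset.sum_nonneg fun k _ => hε.1 _
      -- The factor 1 + η is absorbed by the exponential; the new ε term goes inside the bracket
      -- because the exponential is at least 1.
      have h1 : 1 + η (n + j) ≤ Real.exp (η (n + j)) := by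
        linarith [Real.add_one_le_exp (η (n + j))]
      have h2 : 1 ≤ Real.exp A * Real.exp (η (n + j)) := by
        rw [← Real.exp_add]; exact Real.one_le_exp (add_nonneg hA (hη.1 _))
      have h3 := mul_le_mul_of_nonneg_right h1
        (mul_nonneg (Real.exp_pos A).le (add_nonneg hc hB))
      have h4 := mul_le_mul_of_nonneg_right h2 (hε.1 (n + j))
      linarith
  obtain ⟨j, rfl⟩ := Nat.exists_eq_add_of_le hm
  refine (key j).trans (EReal.coe_le_coe_iff.mpr ?_)
  have hηs : ∑ k ∈ Finset.range j, η (k + n) ≤ ∑' k, η k := by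
    refine (Summable.sum_le_tsum _ (fun k _ => hη.1 _) ((summable_nat_add_iff n).mpr hη.2)).trans ?_
    have h := hη.2.sum_add_tsum_nat_add n
    linarith [Finset.sum_nonneg fun k (_ : k ∈ Finset.range n) => hη.1 k]
  have hεs : ∑ k ∈ Finset.range j, ε (k + n) ≤ ∑' k, ε (k + n) :=
    Summable.sum_le_tsum _ (fun k _ => hε.1 _) ((summable_nat_add_iff n).mpr hε.2)
  have hB : 0 ≤ ∑ k ∈ Finset.range j, ε (k + n) := Finset.sum_nonneg fun k _ => hε.1 _
  gcongr

/-! ### Bounded gradients and convergence of Bregman distances -/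

theorem grad_mem_subdiff (hf : IsGamma0 f) (hfd : IsGateauxDiff f)
    (hy : y ∈ interior (dom f)) : grad f y ∈ subdiff f y := by
  intro z
  by_cases hz : z ∈ dom f
  · have h := realBregmanDist_nonneg hf hfd hz hy
    rw [← coe_toReal_of_mem_dom hf.ne_bot hz,
      ← coe_toReal_of_mem_dom hf.ne_bot (interior_subset hy), ← EReal.coe_add,
      EReal.coe_le_coe_iff]
    rw [realBregmanDist] at h
    linarith
  · rw [show f z = ⊤ from not_lt_top_iff.mp hz]
    exact le_top

/-- A function with locally bounded subdifferential is bounded above near interior points of its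
domain. -/
theorem exists_ball_subset_dom_toReal_le (hf : IsGamma0 f) (hfd : IsGateauxDiff f)
    (hlb : SubdiffLocallyBounded f) (hz : z ∈ interior (dom f)) :
    ∃ r > 0, ∃ M : ℝ, ∀ w ∈ Metric.ball z r, w ∈ dom f ∧ (f w).toReal ≤ M := by
  obtain ⟨U, hU, hbd⟩ := hlb z ⟨_, grad_mem_subdiff hf hfd hz⟩
  obtain ⟨K, hK⟩ := hbd.exists_norm_le
  obtain ⟨r, hr, hsub⟩ := Metric.mem_nhds_iff.mp
    (inter_mem hU (isOpen_interior.mem_nhds hz))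
  -- The gradient inequality at w, tested at z, gives f w ≤ f z + ‖grad f w‖ ‖z - w‖.
  refine ⟨r, hr, (f z).toReal + K * r, fun w hw => ?_⟩
  obtain ⟨hwU, hwi⟩ := hsub hw
  refine ⟨interior_subset hwi, ?_⟩
  have hg : ‖grad f w‖ ≤ K :=
    hK _ (Set.mem_biUnion hwU (grad_mem_subdiff hf hfd hwi))
  have h := realBregmanDist_nonneg hf hfd (interior_subset hz) hwi
  rw [realBregmanDist] at h
  have hn : ‖z - w‖ ≤ r := by
    rw [← dist_eq_norm, dist_comm]; exact (Metric.mem_ball.mp hw).le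
  have h1 : |grad f w (z - w)| ≤ K * r :=
    ((grad f w).le_opNorm (z - w)).trans
      (mul_le_mul hg hn (norm_nonneg _) ((norm_nonneg _).trans hg))
  linarith [neg_abs_le (grad f w (z - w))]

/-- Gradients are bounded on sets where the Bregman distance from a fixed interior point is
bounded. -/
theorem exists_norm_grad_le (hf : IsGamma0 f) (hfd : IsGateauxDiff f)
    (hlb : SubdiffLocallyBounded f) (hz : z ∈ interior (dom f)) (K : ℝ) :
    ∃ L : ℝ, ∀ y ∈ interior (dom f), realBregmanDist f z y ≤ K → ‖grad f y‖ ≤ L := by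
  obtain ⟨r, hr, M, hM⟩ := exists_ball_subset_dom_toReal_le hf hfd hlb hz
  -- Testing the gradient inequality at y on z + w with ‖w‖ = r / 2 bounds the gradient on that
  -- sphere; r / 2 keeps z + w in the open ball.
  refine ⟨max 0 ((K + M - (f z).toReal) / (r / 2)), fun y hy hK => ?_⟩
  have hr2 : 0 < r / 2 := half_pos hr
  have key : ∀ w : X, ‖w‖ = r / 2 → grad f y w ≤ K + M - (f z).toReal := by
    intro w hw
    obtain ⟨hd, hle⟩ := hM (z + w) (by simp [hw, hr])
    have h := realBregmanDist_nonneg hf hfd hd hy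
    rw [realBregmanDist] at h hK
    have hlin : grad f y (z + w - y) = grad f y (z - y) + grad f y w := by
      rw [← map_add]; congr 1; abel
    linarith
  refine ContinuousLinearMap.opNorm_le_bound _ (le_max_left _ _) fun v => ?_
  rcases eq_or_ne v 0 with rfl | hv
  · simp
  have hvn : 0 < ‖v‖ := norm_pos_iff.mpr hv
  have hs : ∀ s : ℝ, |s| = 1 → s * grad f y v ≤ (K + M - (f z).toReal) / (r / 2) * ‖v‖ := by
    intro s hs
    have h := key ((s * (r / 2 / ‖v‖)) • v) (by
      rw [norm_smul, Real.norm_eq_abs, abs_mul, hs, one_mul, abs_of_pos (by positivity),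
        div_mul_cancel₀ _ hvn.ne'])
    rw [map_smul, smul_eq_mul] at h
    rw [div_mul_eq_mul_div, le_div_iff₀ hr2]
    calc s * grad f y v * (r / 2)
        = s * (r / 2 / ‖v‖) * grad f y v * ‖v‖ := by field_simp
      _ ≤ _ := mul_le_mul_of_nonneg_right h hvn.le
  rw [Real.norm_eq_abs]
  refine (abs_le'.mpr ⟨?_, ?_⟩).trans (mul_le_mul_of_nonneg_right (le_max_right _ _) hvn.le)
  · simpa using hs 1 (by simp)
  · simpa using hs (-1) (by simp)

/-- If the gradients stay bounded along a convergent sequence, the limit lies in the domain and the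
Bregman distances from the limit tend to `0`. -/
theorem tendsto_bregmanDist_of_norm_grad_le (hf : IsGamma0 f) (hfd : IsGateauxDiff f)
    {x : ℕ → X} {xbar : X} (hx : ∀ n, x n ∈ interior (dom f)) {L : ℝ}
    (hL : ∀ n, ‖grad f (x n)‖ ≤ L) (hlim : Tendsto x atTop (𝓝 xbar)) :
    Tendsto (fun n => bregmanDist f xbar (x n)) atTop (𝓝 0) := by
  have hgr : ∀ n w, |grad f (x n) w| ≤ L * ‖w‖ := fun n w =>
    ((grad f (x n)).le_opNorm w).trans (mul_le_mul_of_nonneg_right (hL n) (norm_nonneg _))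
  have hdist : Tendsto (fun n => L * ‖xbar - x n‖) atTop (𝓝 0) := by
    simpa using ((tendsto_const_nhds (x := xbar)).sub hlim).norm.const_mul L
  have hdom : xbar ∈ dom f := by
    obtain ⟨z, hz⟩ := hf.nonempty_dom
    have hzd : Tendsto (fun n => (f z).toReal + L * ‖z - x n‖) atTop
        (𝓝 ((f z).toReal + L * ‖z - xbar‖)) :=
      (((tendsto_const_nhds (x := z)).sub hlim).norm.const_mul L).const_add _
    by_contra hcon
    have htop : f xbar = ⊤ := not_lt_top_iff.mp hcon
    -- The gradient inequality keeps f (x n) below f z + L ‖z - x n‖, which converges, so f cannot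
    -- be infinite at xbar.
    have hls := hf.lowerSemicontinuous xbar
      (((f z).toReal + L * ‖z - xbar‖ + 1 : ℝ) : EReal) (by
      change _ < f xbar
      rw [htop]
      exact EReal.coe_lt_top _)
    obtain ⟨n, hn1, hn2⟩ := ((hlim.eventually hls).and
      (hzd.eventually_lt_const (lt_add_one _))).exists
    rw [← coe_toReal_of_mem_dom hf.ne_bot (interior_subset (hx n)), gt_iff_lt, EReal.coe_lt_coe_iff] at hn1
    have h := realBregmanDist_nonneg hf hfd hz (hx n)
    rw [realBregmanDist] at h
    linarith [neg_abs_le (grad f (x n) (z - x n)), hgr n (z - x n)]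
  have heq : (fun n => bregmanDist f xbar (x n)) =
      fun n => ((realBregmanDist f xbar (x n) : ℝ) : EReal) :=
    funext fun n => bregmanDist_eq_coe hf.ne_bot hdom (hx n)
  rw [heq, ← EReal.coe_zero]
  refine (continuous_coe_real_ereal.tendsto 0).comp ?_
  refine tendsto_order.mpr ⟨fun a ha => Eventually.of_forall fun n =>
    ha.trans_le (realBregmanDist_nonneg hf hfd hdom (hx n)), fun a ha => ?_⟩
  have hls := hf.lowerSemicontinuous xbar (((f xbar).toReal - a / 2 : ℝ) : EReal) (by
    change _ < f xbar
    nth_rewrite 2 [← coe_toReal_of_mem_dom hf.ne_bot hdom]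
    rw [EReal.coe_lt_coe_iff]
    linarith)
  filter_upwards [hlim.eventually hls, hdist.eventually_lt_const (half_pos ha)] with n hn1 hn2
  rw [← coe_toReal_of_mem_dom hf.ne_bot (interior_subset (hx n)), gt_iff_lt, EReal.coe_lt_coe_iff] at hn1
  rw [realBregmanDist]
  linarith [neg_abs_le (grad f (x n) (xbar - x n)), hgr n (xbar - x n)]

/-! ### Consistency, interior near-minimizers, and coercivity -/

/-- Under Bregman consistency, small Bregman distance to points of a bounded sequence forces small
norm distance, uniformly. -/
theorem BregmanConsistent.exists_delta (hcons : BregmanConsistent f) (hf : IsGamma0 f)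
    (hfd : IsGateauxDiff f) {x : ℕ → X} (hx : ∀ n, x n ∈ interior (dom f))
    (hbd : Bornology.IsBounded (Set.range x)) {e : ℝ} (he : 0 < e) :
    ∃ δ > 0, ∀ p ∈ interior (dom f), ∀ n, realBregmanDist f p (x n) ≤ δ → ‖p - x n‖ ≤ e := by
  by_contra! hcon
  choose p hp n hpn hn using fun k : ℕ => hcon (1 / ((k : ℝ) + 1)) (by positivity)
  -- The p k may be unbounded, so each is pulled towards x (n k) to distance exactly e. Convexity
  -- keeps the Bregman distance small, and consistency is then contradicted.
  set t : ℕ → ℝ := fun k => e / ‖p k - x (n k)‖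
  have hpos : ∀ k, 0 < ‖p k - x (n k)‖ := fun k => he.trans (hn k)
  have ht0 : ∀ k, 0 ≤ t k := fun k => (div_pos he (hpos k)).le
  have ht1 : ∀ k, t k ≤ 1 := fun k => (div_le_one (hpos k)).mpr (hn k).le
  set u : ℕ → X := fun k => t k • p k + (1 - t k) • x (n k)
  have hdiff : ∀ k, u k - x (n k) = t k • (p k - x (n k)) := fun k => by simp only [u]; module
  have hnorm : ∀ k, ‖u k - x (n k)‖ = e := fun k => by
    rw [hdiff, norm_smul, Real.norm_eq_abs, abs_of_nonneg (ht0 k), div_mul_cancel₀ _ (hpos k).ne']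
  have hu : ∀ k, u k ∈ interior (dom f) := fun k =>
    hf.convexOn.1.interior (hp k) (hx _) (ht0 k) (sub_nonneg.mpr (ht1 k)) (by ring)
  have hvb : Bornology.IsBounded (Set.range fun k => x (n k)) :=
    hbd.subset (Set.range_subset_iff.mpr fun k => ⟨n k, rfl⟩)
  have hub : Bornology.IsBounded (Set.range u) := by
    obtain ⟨R, hR⟩ := hbd.exists_norm_le
    refine (Metric.isBounded_closedBall (x := (0 : X)) (r := e + R)).subset ?_
    rintro _ ⟨k, rfl⟩
    rw [mem_closedBall_zero_iff]
    calc ‖u k‖ = ‖(u k - x (n k)) + x (n k)‖ := by rw [sub_add_cancel]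
      _ ≤ ‖u k - x (n k)‖ + ‖x (n k)‖ := norm_add_le _ _
      _ ≤ e + R := add_le_add (hnorm k).le (hR _ ⟨n k, rfl⟩)
  have hD : Tendsto (fun k => bregmanDist f (u k) (x (n k))) atTop (𝓝 0) := by
    have heq : (fun k => bregmanDist f (u k) (x (n k))) =
        fun k => ((realBregmanDist f (u k) (x (n k)) : ℝ) : EReal) :=
      funext fun k => bregmanDist_eq_coe hf.ne_bot (interior_subset (hu k)) (hx _)
    rw [heq, ← EReal.coe_zero]
    refine (continuous_coe_real_ereal.tendsto 0).comp ?_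
    refine squeeze_zero (fun k => realBregmanDist_nonneg hf hfd (interior_subset (hu k)) (hx _))
      (fun k => ?_) tendsto_one_div_add_atTop_nhds_zero_nat
    have h := realBregmanDist_convex (y := x (n k)) hf (interior_subset (hp k))
      (interior_subset (hx (n k))) (ht0 k) (sub_nonneg.mpr (ht1 k)) (by ring)
    rw [realBregmanDist_self, mul_zero, add_zero] at h
    have h0 := realBregmanDist_nonneg hf hfd (interior_subset (hp k)) (hx (n k))
    exact (h.trans (mul_le_of_le_one_left h0 (ht1 k))).trans (hpn k)
  have hlim := (hcons u _ hu (fun k => hx (n k)) hub hvb hD).norm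
  simp only [hnorm, norm_zero] at hlim
  exact he.ne' (tendsto_nhds_unique tendsto_const_nhds hlim)

/-- The infimum of the Bregman distance over a convex set meeting `int dom f` may be taken over
`int dom f`. -/
theorem exists_mem_interior_realBregmanDist_lt (hf : IsGamma0 f) {C : Set X}
    (hCconvex : Convex ℝ C) (hC : (C ∩ interior (dom f)).Nonempty) (hy : y ∈ interior (dom f))
    {δ : ℝ} (h : bregmanDistSet f C y < (δ : EReal)) :
    ∃ p ∈ C ∩ interior (dom f), realBregmanDist f p y < δ := by
  obtain ⟨z, hzC, hz⟩ := hC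
  simp only [bregmanDistSet, iInf_lt_iff] at h
  obtain ⟨q, hqC, hq⟩ := h
  have hqd : q ∈ dom f := by
    by_contra hcon
    rw [bregmanDist_eq_top hf.ne_bot hcon hy] at hq
    exact not_top_lt hq
  rw [bregmanDist_eq_coe hf.ne_bot hqd hy, EReal.coe_lt_coe_iff] at hq
  -- The near-minimizer q may lie on the boundary; a small move towards z enters the interior and
  -- keeps the strict bound.
  have hlim : Tendsto (fun t : ℝ => t * realBregmanDist f z y + (1 - t) * realBregmanDist f q y)
      (𝓝[>] 0) (𝓝 (realBregmanDist f q y)) := by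
    refine tendsto_nhdsWithin_of_tendsto_nhds ?_
    have hc : Continuous fun t : ℝ =>
        t * realBregmanDist f z y + (1 - t) * realBregmanDist f q y := by fun_prop
    simpa using hc.tendsto 0
  obtain ⟨t, htlt, ht0, ht1⟩ := ((hlim.eventually_lt_const hq).and
    (Ioo_mem_nhdsGT one_pos)).exists
  have h1t : 0 ≤ 1 - t := sub_nonneg.mpr ht1.le
  refine ⟨t • z + (1 - t) • q, ⟨hCconvex hzC hqC ht0.le h1t (by ring),
    hf.convexOn.1.combo_interior_self_mem_interior hz hqd ht0 h1t (by ring)⟩,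
    (realBregmanDist_convex hf (interior_subset hz) hqd ht0.le h1t (by ring)).trans_lt htlt⟩

theorem IsCoercive.isBounded_range {φ : X → EReal} (hφ : IsCoercive φ) {x : ℕ → X} {K : ℝ}
    (hK : ∀ n, φ (x n) ≤ (K : EReal)) : Bornology.IsBounded (Set.range x) := by
  have h : ∀ᶠ y in Bornology.cobounded X, (K : EReal) < φ y :=
    hφ.eventually_const_lt (EReal.coe_lt_top K)
  have hb : Bornology.IsBounded {y | φ y ≤ (K : EReal)} := by
    rw [Bornology.isBounded_def]
    filter_upwards [h] with y hy
    exact not_le.mpr hy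
  exact hb.subset (Set.range_subset_iff.mpr hK)

end Bregman

end QuasiBregman

/-! ### The equivalence -/

open QuasiBregman in
theorem proposition2p12 {X : Type*} [NormedAddCommGroup X] [NormedSpace ℝ X] [CompleteSpace X]
    (hX : QuasiBregman.IsReflexive X)
    (f : X → EReal) (hf : QuasiBregman.IsGamma0 f) (hfd : QuasiBregman.IsGateauxDiff f)
    (hfL : QuasiBregman.IsLegendre f)
    (α : ℝ) (hα : 0 < α)
    (fs : ℕ → X → EReal) (hfs : ∀ n, fs n ∈ QuasiBregman.classP α f)
    (x : ℕ → X) (hx : ∀ n, x n ∈ interior (QuasiBregman.dom f))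
    (C : Set X) (hCclosed : IsClosed C) (hCconvex : Convex ℝ C)
    (hC : (C ∩ interior (QuasiBregman.dom f)).Nonempty)
    (hmono : QuasiBregman.IsStationarilyQuasiBregmanMonotone f fs C x)
    (hcons : QuasiBregman.BregmanConsistent f)
    (hcoer : ∀ z ∈ interior (QuasiBregman.dom f),
      QuasiBregman.IsCoercive (QuasiBregman.bregmanDist f z))
    (β : ℝ) (hβ : 0 < β)
    (hfsβ : ∀ n, QuasiBregman.bregmanLE f (fs n)
      (QuasiBregman.scale β (QuasiBregman.hat f))) :
    (∃ xbar ∈ C ∩ closure (QuasiBregman.dom f), Tendsto x atTop (𝓝 xbar)) ↔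
      liminf (fun n => QuasiBregman.bregmanDistSet f C (x n)) atTop = 0 := by
  obtain ⟨ε, hε, η, hη, hmon⟩ := hmono
  set E := Real.exp (∑' k, η k)
  have hE : 0 < E := Real.exp_pos _
  -- The β comparison is used at time n and the α comparison at time m; the former needs p in the
  -- interior because of `hat`.
  have hstep : ∀ p ∈ C ∩ interior (dom f), ∀ n m, n ≤ m → realBregmanDist f p (x m) ≤
      E * (β * realBregmanDist f p (x n) + ∑' k, ε (k + n)) / α := by
    intro p hp n m hnm
    have h0 := realBregmanDist_nonneg hf hfd (interior_subset hp.2) (hx n)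
    rw [le_div_iff₀' hα]
    exact mul_realBregmanDist_le_of_bregmanLE hα hf.ne_bot hfd (hfs m).2 (interior_subset hp.2)
      (hx m) (le_exp_mul_of_le_mul_add (a := fun n => bregmanDist (fs n) p (x n)) hε hη
        (hmon p ⟨hp.1, interior_subset hp.2⟩) (mul_nonneg hβ.le h0)
        (bregmanDist_le_mul_of_bregmanLE_hat hβ hf.ne_bot hfd (hfsβ n) hp.2 (hx n)) hnm)
  obtain ⟨z, hz⟩ := hC
  obtain ⟨K, hK⟩ : ∃ K, ∀ n, realBregmanDist f z (x n) ≤ K :=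
    ⟨_, fun n => hstep z hz 0 n n.zero_le⟩
  constructor
  · rintro ⟨xbar, ⟨hxC, -⟩, hlim⟩
    obtain ⟨L, hL⟩ := exists_norm_grad_le hf hfd hfL.1.1 hz.2 K
    have ht := tendsto_bregmanDist_of_norm_grad_le hf hfd hx (fun n => hL _ (hx n) (hK n)) hlim
    have h0 : Tendsto (fun n => bregmanDistSet f C (x n)) atTop (𝓝 0) :=
      tendsto_of_tendsto_of_tendsto_of_le_of_le tendsto_const_nhds ht
        (fun n => le_iInf₂ fun q _ => bregmanDist_nonneg hf hfd (hx n))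
        (fun n => iInf₂_le xbar hxC)
    exact h0.liminf_eq
  · intro hlim
    have hbd : Bornology.IsBounded (Set.range x) :=
      (hcoer z hz.2).isBounded_range (K := K) fun n => by
        rw [bregmanDist_eq_coe hf.ne_bot (interior_subset hz.2) (hx n)]
        exact_mod_cast hK n
    have hnear : ∀ e > 0, ∃ p ∈ C, ∃ n, ∀ m, n ≤ m → ‖p - x m‖ ≤ e := by
      intro e he
      obtain ⟨δ, hδ, hδe⟩ := hcons.exists_delta hf hfd hx hbd he
      -- Both β D^f(p, x n) and the tail of ε will be below c, so that E * (c + c) / α = δ.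
      set c : ℝ := α * δ / (2 * E)
      have hc : 0 < c := by positivity
      have hfreq : ∃ᶠ n in atTop, bregmanDistSet f C (x n) < ((c / β : ℝ) : EReal) :=
        frequently_lt_of_liminf_lt (by isBoundedDefault)
          (by rw [hlim]; exact_mod_cast div_pos hc hβ)
      obtain ⟨n, hn1, hn2⟩ := (hfreq.and_eventually
        ((tendsto_sum_nat_add ε).eventually_lt_const hc)).exists
      obtain ⟨p, hp, hpn⟩ := exists_mem_interior_realBregmanDist_lt hf hCconvex ⟨z, hz⟩ (hx n) hn1
      refine ⟨p, hp.1, n, fun m hm => hδe p hp.2 m ((hstep p hp n m hm).trans ?_)⟩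
      rw [lt_div_iff₀' hβ] at hpn
      calc E * (β * realBregmanDist f p (x n) + ∑' k, ε (k + n)) / α ≤ E * (c + c) / α := by
            gcongr
        _ = δ := by simp only [c]; field_simp; ring
    have hcau : CauchySeq x := by
      refine Metric.cauchySeq_iff'.mpr fun e he => ?_
      obtain ⟨p, -, n, hn⟩ := hnear (e / 3) (by positivity)
      refine ⟨n, fun m hm => ?_⟩
      have h1 := hn m hm
      have h2 := hn n le_rfl
      rw [← dist_eq_norm] at h1 h2
      linarith [dist_triangle_left (x m) (x n) p]
    obtain ⟨xbar, hxbar⟩ := cauchySeq_tendsto_of_complete hcau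
    refine ⟨xbar, ⟨?_, ?_⟩, hxbar⟩
    · rw [← hCclosed.closure_eq, Metric.mem_closure_iff]
      intro e he
      obtain ⟨p, hpC, n, hn⟩ := hnear (e / 2) (by positivity)
      refine ⟨p, hpC, ?_⟩
      have h : ‖p - xbar‖ ≤ e / 2 := le_of_tendsto (tendsto_const_nhds.sub hxbar).norm
        (eventually_atTop.mpr ⟨n, hn⟩)
      rw [dist_comm, dist_eq_norm]
      linarith
    · exact mem_closure_of_tendsto hxbar (Eventually.of_forall fun n => interior_subset (hx n))
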